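/- For a complex Hilbert space $H$ and $\rho>0$, let $C_\rho(H)$ be the set of bounded operators $T$ on $H$ that admit a unitary $\rho$-dilation: there are a Hilbert space $\mathcal H\supseteq H$ and a unitary $U$ on $\mathcal H$ with $T^n=\rho P_H U^n|_H$ for all $n\ge 1$. For $T_0,T_1\in C_\rho(H)$, say that $T_1$ is Harnack dominated by $T_0$ if there is $c\ge 1$ such that \[ \operatorname{Re}p(T_1)\le c^2\operatorname{Re}p(T_0)+(c^2-1)(\rho-1)\operatorname{Re}p(0_H) \] for every complex polynomial $p$ with $\operatorname{Re}p\ge 0$ on the closed unit disk (where $\operatorname{Re}X=\frac12(X+X^*)$). Two elements are Harnack equivalent if each is Harnack dominated by the other; the equivalence classes are the Harnack parts of $C_\rho(H)$. Let $S\in C_2(\mathbb C^5)$ be the matrix, in the canonical basis $e_0,\dots,e_4$, with entries $a=1/\cos(\pi/6)$ on the first superdiagonal and $0$ elsewhere. Every $T$ in the Harnack part of $S$ in $C_2(\mathbb C^5)$ has, with respect to $\mathbb C^5=\mathbb Ce_0\oplus(\mathbb Ce_1\oplus\mathbb Ce_2\oplus\mathbb Ce_3)\oplus\mathbb Ce_4$,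 the block form \[ T=\begin{bmatrix}0&A&0\\0&R&B\\0&0&0\end{bmatrix},\qquad A\in\mathbb C^{1\times 3},\ R\in\mathbb C^{3\times 3},\ B\in\mathbb C^{3\times 1}. \] There is no $T$ in the Harnack part of $S$ in $C_2(\mathbb C^5)$ whose block $R$ satisfies $\sigma(R)=\{0,\lambda_1,\lambda_2\}$ with $\lambda_1,\lambda_2$ nonzero, distinct and in the open unit disk. Moreover, for every $T$ in the Harnack part of $S$, the block $R$ is nilpotent. -/

import Mathlib

noncomputable section

/-- `T` is a `ρ`-contraction: it has a unitary `ρ`-dilation, i.e. a unitary operator `U` on a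
Hilbert space `K` containing `H` (through a linear isometry `V`, so that `V* X V` is the compression
of `X` to `H`) such that `T ^ n = ρ P_H U ^ n |_H` for all `n ≥ 1`. -/
def IsRhoContraction {H : Type} [NormedAddCommGroup H] [InnerProductSpace ℂ H] [CompleteSpace H]
    (ρ : ℝ) (T : H →L[ℂ] H) : Prop :=
  ∃ (K : Type) (_ : NormedAddCommGroup K) (_ : InnerProductSpace ℂ K) (_ : CompleteSpace K)
    (V : H →ₗᵢ[ℂ] K) (U : K →L[ℂ] K), U ∈ unitary (K →L[ℂ] K) ∧
      ∀ n : ℕ, 1 ≤ n →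
        T ^ n = (ρ : ℂ) • ((ContinuousLinearMap.adjoint V.toContinuousLinearMap) ∘L (U ^ n) ∘L
          V.toContinuousLinearMap)

/-- The real part `(X + X*) / 2` of an operator. -/
def opRe {H : Type} [NormedAddCommGroup H] [InnerProductSpace ℂ H] [CompleteSpace H]
    (X : H →L[ℂ] H) : H →L[ℂ] H :=
  (2⁻¹ : ℂ) • (X + ContinuousLinearMap.adjoint X)

/-- `T₁` is Harnack dominated by `T₀` (as `ρ`-contractions); `≤` is the Loewner order. -/
def HarnackDominated {H : Type} [NormedAddCommGroup H] [InnerProductSpace ℂ H] [CompleteSpace H]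
    (ρ : ℝ) (T₁ T₀ : H →L[ℂ] H) : Prop :=
  ∃ c : ℝ, 1 ≤ c ∧ ∀ p : Polynomial ℂ, (∀ z : ℂ, ‖z‖ ≤ 1 → 0 ≤ (p.eval z).re) →
    opRe (Polynomial.aeval T₁ p) ≤
      ((c ^ 2 : ℝ) : ℂ) • opRe (Polynomial.aeval T₀ p) +
        (((c ^ 2 - 1) * (ρ - 1) : ℝ) : ℂ) • opRe (Polynomial.aeval (0 : H →L[ℂ] H) p)

/-- The Harnack part of `T₀` in the class of `ρ`-contractions on `H`. -/
def harnackPart {H : Type} [NormedAddCommGroup H] [InnerProductSpace ℂ H] [CompleteSpace H]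
    (ρ : ℝ) (T₀ : H →L[ℂ] H) : Set (H →L[ℂ] H) :=
  {T | IsRhoContraction ρ T ∧ HarnackDominated ρ T T₀ ∧ HarnackDominated ρ T₀ T}

/-- A `5 × 5` matrix as an operator on `ℂ⁵` with its Euclidean inner product. -/
def matOp (T : Matrix (Fin 5) (Fin 5) ℂ) :
    EuclideanSpace ℂ (Fin 5) →L[ℂ] EuclideanSpace ℂ (Fin 5) :=
  Matrix.toEuclideanCLM (n := Fin 5) (𝕜 := ℂ) T

/-- The truncated shift of size five, normalized to have numerical radius one. -/
def truncShift : Matrix (Fin 5) (Fin 5) ℂ :=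
  ((1 / Real.cos (Real.pi / 6) : ℝ) : ℂ) •
    !![0, 1, 0, 0, 0;
       0, 0, 1, 0, 0;
       0, 0, 0, 1, 0;
       0, 0, 0, 0, 1;
       0, 0, 0, 0, 0]

/-- The block matrix with rows `(0, A, 0)`, `(0, R, B)`, `(0, 0, 0)` with respect to
`ℂ⁵ = ℂ ⊕ ℂ³ ⊕ ℂ`. -/
def blockForm (A : Fin 3 → ℂ) (R : Matrix (Fin 3) (Fin 3) ℂ) (B : Fin 3 → ℂ) :
    Matrix (Fin 5) (Fin 5) ℂ :=
  !![0, A 0,   A 1,   A 2,   0;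
     0, R 0 0, R 0 1, R 0 2, B 0;
     0, R 1 0, R 1 1, R 1 2, B 1;
     0, R 2 0, R 2 1, R 2 2, B 2;
     0, 0,     0,     0,     0]

end

/-! Every T in the Harnack part is forced to be a weighted superdiagonal matrix, from which the
block form, the nilpotency of R and the absence of nonzero eigenvalues are immediate.

S has numerical radius one: for |w| = 1, Re(wS) has top eigenvalue 1, with eigenvector y. Since 2 Re
(1 - wS)⁻¹ = (1 - wS)⁻¹ (2 - wS - (wS)*) (1 - wS)⁻*, the vector (1 - wS)* y spans the kernel of Re
(1 - wS)⁻¹; up to scaling it is x_w = ∑ w⁻ʲ x_j, with coefficients (-√3, -1, 0, 1, √3). Harnack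
domination passes this kernel on to T. As T may have spectrum on the circle, (1 - wT)⁻¹ is replaced
by sums G_N(wT) of partial sums of the geometric series. These come from Fejér-type polynomials and
satisfy 0 ≤ Re G_N(wT) ≤ c Re G_N(wS) (`IsRhoContraction.re_inner_geomCesaro_nonneg`,
`HarnackDominated.exists_re_inner_geomCesaro_le`).

At x_w the form of Re G_N(wS) is bounded in N, while its norm is O(N). Cauchy–Schwarz gives ‖Re
G_N(wT) x_w‖² = O(N), so after division by N every Fourier coefficient in w tends to 0. The limits
are ∑ K(m + j) x_j, with K the Toeplitz kernel of T (`sum_toeplitzKernel_eq_zero`). Seven of these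
identities determine the shape of T by linear algebra (`exists_superdiagonal_of_kernel_eq`). -/

/-- The sum of the first `N` partial sums of the geometric series of `a`. -/
def geomCesaro {R : Type*} [Semiring R] (a : R) (N : ℕ) : R :=
  ∑ k ∈ Finset.range N, ∑ i ∈ Finset.range (k + 1), a ^ i

theorem map_geomCesaro {R S F : Type*} [Semiring R] [Semiring S] [FunLike F R S]
    [RingHomClass F R S] (f : F) (a : R) (N : ℕ) :
    f (geomCesaro a N) = geomCesaro (f a) N := by
  simp [geomCesaro, map_sum, map_pow]

theorem geomCesaro_zero {R : Type*} [Semiring R] (N : ℕ) : geomCesaro (0 : R) N = N := by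
  have h : ∀ k : ℕ, ∑ i ∈ Finset.range (k + 1), (0 : R) ^ i = 1 := by
    intro k
    rw [Finset.sum_range_succ']
    simp
  simp [geomCesaro, h]

/-! ### Positivity of summed geometric series of contractions -/

section Positivity

variable {H : Type*} [NormedAddCommGroup H] [InnerProductSpace ℂ H]

theorem geomCesaro_apply (C : H →L[ℂ] H) (N : ℕ) (h : H) :
    geomCesaro C N h = ∑ k ∈ Finset.range N, ∑ i ∈ Finset.range (k + 1), (C ^ i) h := by
  simp [geomCesaro]

/-- The partial sums obey s (k + 1) = h + C (s k), so ‖s (k + 1) - h‖ ≤ ‖s k‖. Expanding the square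
and summing over k telescopes. -/
theorem le_re_inner_geomCesaro {C : H →L[ℂ] H} (hC : ∀ v, ‖C v‖ ≤ ‖v‖) (N : ℕ) (h : H) :
    N * ‖h‖ ^ 2 ≤ 2 * (inner ℂ h (geomCesaro C N h)).re := by
  let s : ℕ → H := fun k => ∑ i ∈ Finset.range k, (C ^ i) h
  have hs : ∀ k, s (k + 1) = h + C (s k) := by
    intro k
    simp only [s]
    rw [Finset.sum_range_succ', map_sum, add_comm]
    simp [pow_succ']
  have key : ∀ k, ‖s (k + 1)‖ ^ 2 - ‖s k‖ ^ 2 ≤ 2 * (inner ℂ h (s (k + 1))).re - ‖h‖ ^ 2 := by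
    intro k
    have h1 : s (k + 1) - h = C (s k) := by rw [hs]; abel
    have h2 : ‖s (k + 1) - h‖ ^ 2 ≤ ‖s k‖ ^ 2 := by
      rw [h1]; exact pow_le_pow_left₀ (norm_nonneg _) (hC _) 2
    have h3 := @norm_sub_sq ℂ H _ _ _ (s (k + 1)) h
    have h4 : RCLike.re (inner ℂ (s (k + 1)) h) = (inner ℂ h (s (k + 1))).re :=
      inner_re_symm (𝕜 := ℂ) _ _
    rw [h4] at h3
    linarith
  have tot : ‖s N‖ ^ 2 - ‖s 0‖ ^ 2 ≤
      ∑ k ∈ Finset.range N, (2 * (inner ℂ h (s (k + 1))).re - ‖h‖ ^ 2) := by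
    rw [← Finset.sum_range_sub (fun k => ‖s k‖ ^ 2)]
    exact Finset.sum_le_sum fun k _ => key k
  have s0 : s 0 = 0 := by simp [s]
  rw [Finset.sum_sub_distrib, ← Finset.mul_sum, s0] at tot
  rw [geomCesaro_apply, inner_sum, Complex.re_sum]
  simp only [Finset.sum_const, Finset.card_range, nsmul_eq_mul, norm_zero] at tot
  have := sq_nonneg ‖s N‖
  simp only [s] at tot this
  linarith

theorem le_re_geomCesaro {z : ℂ} (hz : ‖z‖ ≤ 1) (N : ℕ) :
    (N : ℝ) ≤ 2 * (geomCesaro z N).re := by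
  have := le_re_inner_geomCesaro (C := z • (1 : ℂ →L[ℂ] ℂ)) (fun v => by
    simpa using mul_le_of_le_one_left (norm_nonneg v) hz) N 1
  rw [geomCesaro_apply] at this
  simpa [smul_pow, geomCesaro] using this

theorem re_natCast_mul_inner_self (N : ℕ) (h : H) :
    ((N : ℂ) * inner ℂ h h).re = N * ‖h‖ ^ 2 := by
  rw [← Complex.ofReal_natCast, Complex.re_ofReal_mul]
  congr 1
  exact inner_self_eq_norm_sq (𝕜 := ℂ) h

end Positivity

/-! ### Dilations and Harnack domination tested on Fejér-type polynomials -/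

section Harnack

variable {H : Type} [NormedAddCommGroup H] [InnerProductSpace ℂ H] [CompleteSpace H]

/-- Each positive power of T is twice the compression of that of U, but the zeroth power is the
compression itself. The surplus N‖h‖² is exactly what the contraction bound for wU absorbs. -/
theorem IsRhoContraction.re_inner_geomCesaro_nonneg {T : H →L[ℂ] H} (hT : IsRhoContraction 2 T)
    {w : ℂ} (hw : ‖w‖ ≤ 1) (N : ℕ) (h : H) :
    0 ≤ (inner ℂ h (geomCesaro (w • T) N h)).re := by
  obtain ⟨K, _, _, _, V, U, hU, hT⟩ := hT
  have hUn : ∀ v, ‖(w • U) v‖ ≤ ‖v‖ := by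
    intro v
    have h1 : ‖U v‖ = ‖v‖ := ContinuousLinearMap.norm_map_of_mem_unitary hU v
    rw [smul_apply, norm_smul, h1]
    exact mul_le_of_le_one_left (norm_nonneg v) hw
  have h1 := le_re_inner_geomCesaro hUn N (V h)
  have h2 : ∀ k : ℕ, inner ℂ h (∑ i ∈ Finset.range (k + 1), ((w • T) ^ i) h) =
      2 * inner ℂ (V h) (∑ i ∈ Finset.range (k + 1), ((w • U) ^ i) (V h)) - inner ℂ h h := by
    intro k
    rw [Finset.sum_range_succ', Finset.sum_range_succ', inner_add_right, inner_add_right,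
      inner_sum, inner_sum, mul_add, Finset.mul_sum]
    have h3 : ∀ i ∈ Finset.range k, inner ℂ h (((w • T) ^ (i + 1)) h) =
        2 * inner ℂ (V h) (((w • U) ^ (i + 1)) (V h)) := by
      intro i _
      rw [smul_pow, smul_pow, hT (i + 1) (by omega)]
      simp only [smul_apply, ContinuousLinearMap.comp_apply, inner_smul_right,
        ContinuousLinearMap.adjoint_inner_right, LinearIsometry.coe_toContinuousLinearMap]
      push_cast
      ring
    rw [Finset.sum_congr rfl h3]
    simp only [pow_zero, one_apply_eq_self, LinearIsometry.inner_map_map]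
    ring
  have h4 : inner ℂ h (geomCesaro (w • T) N h) =
      2 * inner ℂ (V h) (geomCesaro (w • U) N (V h)) - N * inner ℂ h h := by
    rw [geomCesaro_apply, geomCesaro_apply, inner_sum, inner_sum,
      Finset.sum_congr rfl fun k _ => h2 k,
      Finset.sum_sub_distrib, Finset.mul_sum, Finset.sum_const, Finset.card_range, nsmul_eq_mul]
  rw [V.norm_map] at h1
  have h6 : ∀ a : ℂ, (2 * a).re = 2 * a.re := by intro a; simp
  rw [h4, Complex.sub_re, h6, re_natCast_mul_inner_self]
  linarith

theorem re_inner_opRe (X : H →L[ℂ] H) (h : H) :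
    (inner ℂ h (opRe X h)).re = (inner ℂ h (X h)).re := by
  have h1 : (inner ℂ h (ContinuousLinearMap.adjoint X h)).re = (inner ℂ h (X h)).re := by
    rw [ContinuousLinearMap.adjoint_inner_right]
    exact inner_re_symm (𝕜 := ℂ) _ _
  simp only [opRe, smul_apply, add_apply,
    inner_smul_right, inner_add_right]
  rw [show (2⁻¹ : ℂ) = ((2⁻¹ : ℝ) : ℂ) by push_cast; rfl, Complex.re_ofReal_mul, Complex.add_re, h1]
  ring

theorem HarnackDominated.exists_re_inner_geomCesaro_le {T S : H →L[ℂ] H}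
    (hTS : HarnackDominated 2 T S) :
    ∃ c : ℝ, 0 ≤ c ∧ ∀ (w : ℂ), ‖w‖ ≤ 1 → ∀ (N : ℕ) (h : H),
      (inner ℂ h (geomCesaro (w • T) N h)).re ≤ c * (inner ℂ h (geomCesaro (w • S) N h)).re := by
  obtain ⟨c, -, hc⟩ := hTS
  refine ⟨c ^ 2, sq_nonneg c, fun w hw N h => ?_⟩
  -- For |wz| = 1 the real part of p at z is N times the Fejér kernel. Since p(0) = N and ρ = 2, the
  -- constant terms in the domination inequality cancel, leaving a pure comparison of the two sums.
  let p : Polynomial ℂ := 2 * geomCesaro (Polynomial.C w * Polynomial.X) N - N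
  have hp : ∀ z : ℂ, ‖z‖ ≤ 1 → 0 ≤ (p.eval z).re := by
    intro z hz
    have h1 : p.eval z = 2 * geomCesaro (w * z) N - N := by
      simp only [p, Polynomial.eval_sub, Polynomial.eval_mul, Polynomial.eval_natCast,
        Polynomial.eval_ofNat]
      rw [← Polynomial.coe_evalRingHom, map_geomCesaro]
      simp
    have h2 := le_re_geomCesaro (z := w * z)
      (by rw [norm_mul]; exact mul_le_one₀ hw (norm_nonneg _) hz) N
    rw [h1]
    simpa using h2
  have haev : ∀ X : H →L[ℂ] H, Polynomial.aeval X p = 2 * geomCesaro (w • X) N - N := by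
    intro X
    simp only [p, map_sub, map_mul, map_natCast, map_geomCesaro, Polynomial.aeval_X,
      Polynomial.aeval_C, map_ofNat]
    rw [Algebra.smul_def]
  have hin : ∀ X : H →L[ℂ] H, (inner ℂ h (opRe (Polynomial.aeval X p) h)).re =
      2 * (inner ℂ h (geomCesaro (w • X) N h)).re - N * ‖h‖ ^ 2 := by
    intro X
    have h1 : (2 * geomCesaro (w • X) N - (N : H →L[ℂ] H)) h =
        (2 : ℂ) • geomCesaro (w • X) N h - (N : ℂ) • h := by
      rw [two_mul, two_smul, ← nsmul_one]
      simp [Nat.cast_smul_eq_nsmul]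
    rw [re_inner_opRe, haev, h1, inner_sub_right, inner_smul_right, inner_smul_right,
      Complex.sub_re, re_natCast_mul_inner_self]
    simp
  have h0 : (inner ℂ h (geomCesaro (w • (0 : H →L[ℂ] H)) N h)).re = N * ‖h‖ ^ 2 := by
    rw [smul_zero, geomCesaro_zero, ← nsmul_one, smul_apply,
      one_apply_eq_self, ← Nat.cast_smul_eq_nsmul ℂ, inner_smul_right,
      re_natCast_mul_inner_self]
  have h2 := (ContinuousLinearMap.le_def _ _).1 (hc p hp)
  have h3 := h2.re_inner_nonneg_right h
  simp only [sub_apply, add_apply,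
    smul_apply, inner_sub_right, inner_add_right, inner_smul_right, map_sub,
    map_add, RCLike.re_to_complex, Complex.re_ofReal_mul, hin, h0] at h3
  linarith

end Harnack

/-! ### Cauchy–Schwarz for a positive operator -/

section Bound

variable {H : Type*} [NormedAddCommGroup H] [InnerProductSpace ℂ H] [CompleteSpace H]

/-- Positivity of the form at x - D⁻¹ F x, with the upper bound applied at F x. -/
theorem norm_sq_apply_le_of_re_inner_le {F : H →L[ℂ] H} (hF : ContinuousLinearMap.adjoint F = F)
    {D : ℝ} (hD : 0 < D) (h0 : ∀ h, 0 ≤ (inner ℂ h (F h)).re)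
    (h1 : ∀ h, (inner ℂ h (F h)).re ≤ D * ‖h‖ ^ 2) (x : H) :
    ‖F x‖ ^ 2 ≤ D * (inner ℂ x (F x)).re := by
  have h2 := h0 (x - ((D⁻¹ : ℝ) : ℂ) • F x)
  have h3 := h1 (F x)
  have h4 : inner ℂ x (F (F x)) = inner ℂ (F x) (F x) := by
    nth_rw 1 [← hF]
    rw [ContinuousLinearMap.adjoint_inner_right]
  have h5 : (inner ℂ (F x) (F x)).re = ‖F x‖ ^ 2 := inner_self_eq_norm_sq (𝕜 := ℂ) (F x)
  simp only [map_sub, map_smul, inner_sub_left, inner_sub_right, inner_smul_left, inner_smul_right,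
    Complex.conj_ofReal, Complex.sub_re, Complex.re_ofReal_mul, h4, h5] at h2
  have h6 : D⁻¹ * (D⁻¹ * (inner ℂ (F x) (F (F x))).re) ≤ D⁻¹ * ‖F x‖ ^ 2 := by
    apply mul_le_mul_of_nonneg_left _ (inv_nonneg.2 hD.le)
    rw [inv_mul_le_iff₀ hD]
    exact h3
  have h7 : D⁻¹ * ‖F x‖ ^ 2 ≤ (inner ℂ x (F x)).re := by linarith
  rwa [inv_mul_le_iff₀ hD] at h7

end Bound

/-! ### Fourier coefficients on the circle and Cesàro limits -/

section Coefficients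

variable {E : Type*} [NormedAddCommGroup E] [NormedSpace ℂ E]

/-- `c` is the family of Fourier coefficients of the continuous function `f` on the unit circle. -/
def HasCircleCoeff (f : ℂ → E) (c : ℤ → E) : Prop :=
  ContinuousOn f (Metric.sphere 0 1) ∧
    ∀ m : ℤ, (∮ z in C(0, 1), z ^ (-m - 1) • f z) = (2 * Real.pi * Complex.I : ℂ) • c m

theorem continuousOn_zpow_sphere (n : ℤ) :
    ContinuousOn (fun z : ℂ => z ^ n) (Metric.sphere 0 1) := by
  intro z hz
  refine (continuousAt_zpow₀ z n (Or.inl ?_)).continuousWithinAt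
  rintro rfl
  simp at hz

theorem HasCircleCoeff.add {f g : ℂ → E} {c d : ℤ → E} (hf : HasCircleCoeff f c)
    (hg : HasCircleCoeff g d) : HasCircleCoeff (fun z => f z + g z) (fun m => c m + d m) := by
  refine ⟨hf.1.add hg.1, fun m => ?_⟩
  simp only [smul_add]
  rw [circleIntegral.integral_add, hf.2, hg.2]
  · exact ((continuousOn_zpow_sphere _).smul hf.1).circleIntegrable zero_le_one
  · exact ((continuousOn_zpow_sphere _).smul hg.1).circleIntegrable zero_le_one

theorem HasCircleCoeff.zero : HasCircleCoeff (fun _ => (0 : E)) (fun _ => 0) :=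
  ⟨continuousOn_const, fun m => by simp [circleIntegral]⟩

theorem HasCircleCoeff.sum {ι : Type*} (s : Finset ι) {f : ι → ℂ → E} {c : ι → ℤ → E}
    (h : ∀ i, HasCircleCoeff (f i) (c i)) :
    HasCircleCoeff (fun z => ∑ i ∈ s, f i z) (fun m => ∑ i ∈ s, c i m) := by
  classical
  induction s using Finset.induction_on with
  | empty => simpa using HasCircleCoeff.zero
  | insert a s ha ih => simpa only [Finset.sum_insert ha] using (h a).add ih

theorem hasCircleCoeff_zpow_smul [CompleteSpace E] (n : ℤ) (v : E) :
    HasCircleCoeff (fun z => z ^ n • v) (fun m => if m = n then v else 0) := by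
  refine ⟨(continuousOn_zpow_sphere n).smul continuousOn_const, fun m => ?_⟩
  have h1 : (∮ z in C(0, 1), z ^ (-m - 1) • z ^ n • v) = ∮ z in C(0, 1), z ^ (n - m - 1) • v := by
    refine circleIntegral.integral_congr zero_le_one fun z hz => ?_
    have hz0 : z ≠ 0 := by
      rintro rfl
      simp at hz
    simp only [smul_smul]
    rw [← zpow_add₀ hz0]
    congr 2
    ring
  rw [h1, circleIntegral.integral_smul_const]
  beta_reduce
  split_ifs with hmn
  · subst hmn
    have := circleIntegral.integral_sub_center_inv (0 : ℂ) (R := 1) one_ne_zero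
    simp only [sub_zero] at this
    simp [this]
  · have := circleIntegral.integral_sub_zpow_of_ne (n := n - m - 1) (by omega) 0 0 1
    simp only [sub_zero] at this
    simp [this]

theorem HasCircleCoeff.norm_le {f : ℂ → E} {c : ℤ → E} (h : HasCircleCoeff f c) {B : ℝ}
    (hB : ∀ z : ℂ, ‖z‖ = 1 → ‖f z‖ ≤ B) (m : ℤ) : ‖c m‖ ≤ B := by
  have h1 : ‖∮ z in C(0, 1), z ^ (-m - 1) • f z‖ ≤ 2 * Real.pi * 1 * B := by
    refine circleIntegral.norm_integral_le_of_norm_le_const zero_le_one fun z hz => ?_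
    have hz1 : ‖z‖ = 1 := by simpa using hz
    rw [norm_smul, norm_zpow, hz1, one_zpow, one_mul]
    exact hB z hz1
  rw [h.2, norm_smul] at h1
  have h2 : ‖(2 * Real.pi * Complex.I : ℂ)‖ = 2 * Real.pi := by
    simp [abs_of_pos Real.pi_pos]
  rw [h2, mul_one] at h1
  exact le_of_mul_le_mul_left h1 (by positivity)

/-- The Cesàro means of u converge to l, yet their norms are O(N^(-1/2)). -/
theorem eq_zero_of_norm_sum_range_sq_le {u : ℕ → E} {l : E} {M : ℕ} (hu : ∀ k, M ≤ k → u k = l)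
    {B : ℝ} (hB : ∀ N : ℕ, ‖∑ k ∈ Finset.range N, u k‖ ^ 2 ≤ B * N) : l = 0 := by
  let _ : NormedSpace ℝ E := NormedSpace.restrictScalars ℝ ℂ E
  have h1 : Filter.Tendsto u Filter.atTop (nhds l) :=
    tendsto_const_nhds.congr' (Filter.eventually_atTop.2 ⟨M, fun k hk => (hu k hk).symm⟩)
  have h2 := h1.cesaro_smul
  have h3 : Filter.Tendsto (fun n : ℕ => ‖((n : ℝ)⁻¹) • ∑ i ∈ Finset.range n, u i‖ ^ 2)
      Filter.atTop (nhds (‖l‖ ^ 2)) := h2.norm.pow 2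
  have h4 : Filter.Tendsto (fun n : ℕ => B * (n : ℝ)⁻¹) Filter.atTop (nhds 0) := by
    simpa using (tendsto_inv_atTop_nhds_zero_nat (𝕜 := ℝ)).const_mul B
  have h5 : ‖l‖ ^ 2 ≤ 0 := by
    refine le_of_tendsto_of_tendsto h3 h4 (Filter.eventually_atTop.2 ⟨1, fun n hn => ?_⟩)
    have hn0 : (0 : ℝ) < n := by exact_mod_cast hn
    beta_reduce
    rw [norm_smul, norm_inv, Real.norm_natCast, mul_pow]
    calc ((n : ℝ)⁻¹) ^ 2 * ‖∑ i ∈ Finset.range n, u i‖ ^ 2 ≤ ((n : ℝ)⁻¹) ^ 2 * (B * n) :=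
          mul_le_mul_of_nonneg_left (hB n) (by positivity)
      _ = B * (n : ℝ)⁻¹ := by field_simp
  have h6 : ‖l‖ = 0 := by nlinarith [norm_nonneg l]
  exact norm_eq_zero.1 h6

end Coefficients

/-! ### From growth bounds to Toeplitz kernel identities -/

section Kernel

variable {H : Type*} [NormedAddCommGroup H] [InnerProductSpace ℂ H] [CompleteSpace H]

/-- The Toeplitz kernel of a `2`-contraction: `T ^ n` for `n > 0`, `2` for `n = 0` and
`(T*) ^ (-n)` for `n < 0`. -/
noncomputable def toeplitzKernel (T : H →L[ℂ] H) (n : ℤ) : H →L[ℂ] H :=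
  (if 0 ≤ n then T ^ n.toNat else 0) +
    if n ≤ 0 then (ContinuousLinearMap.adjoint T) ^ (-n).toNat else 0

theorem adjoint_pow (T : H →L[ℂ] H) (i : ℕ) :
    ContinuousLinearMap.adjoint (T ^ i) = ContinuousLinearMap.adjoint T ^ i := by
  rw [← ContinuousLinearMap.star_eq_adjoint, ← ContinuousLinearMap.star_eq_adjoint, star_pow]

theorem sum_toeplitzKernel_eq_zero {n : ℕ} (T : H →L[ℂ] H) (x : Fin n → H) {B : ℝ}
    (hB : ∀ w : ℂ, ‖w‖ = 1 → ∀ N : ℕ,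
      ‖(geomCesaro (w • T) N + ContinuousLinearMap.adjoint (geomCesaro (w • T) N))
        (∑ j : Fin n, (w⁻¹ ^ (j : ℕ)) • x j)‖ ^ 2 ≤ B * N) (m : ℤ) :
    ∑ j : Fin n, toeplitzKernel T (m + (j : ℕ)) (x j) = 0 := by
  -- The m-th Fourier coefficient of the k-th partial sum: on the circle the adjoint of w is w⁻¹, so
  -- T ^ i and its adjoint, applied to w⁻ʲ x_j, have frequencies i - j and -i - j.
  let c : ℕ → ℤ → H := fun k m => ∑ i ∈ Finset.range (k + 1), ∑ j : Fin n,
    ((if m = (i : ℤ) - (j : ℕ) then (T ^ i) (x j) else 0) +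
      if m = -(i : ℤ) - (j : ℕ) then (ContinuousLinearMap.adjoint T ^ i) (x j) else 0)
  have hcoef : ∀ N : ℕ, HasCircleCoeff (fun z : ℂ => ∑ k ∈ Finset.range N,
      ∑ i ∈ Finset.range (k + 1), ∑ j : Fin n, (z ^ ((i : ℤ) - (j : ℕ)) • (T ^ i) (x j) +
        z ^ (-(i : ℤ) - (j : ℕ)) • (ContinuousLinearMap.adjoint T ^ i) (x j)))
      (fun m => ∑ k ∈ Finset.range N, c k m) := fun N =>
    HasCircleCoeff.sum _ fun k => HasCircleCoeff.sum _ fun i => HasCircleCoeff.sum _ fun j =>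
      (hasCircleCoeff_zpow_smul _ _).add (hasCircleCoeff_zpow_smul _ _)
  have hval : ∀ (N : ℕ) (w : ℂ), ‖w‖ = 1 →
      (geomCesaro (w • T) N + ContinuousLinearMap.adjoint (geomCesaro (w • T) N))
        (∑ j : Fin n, (w⁻¹ ^ (j : ℕ)) • x j) = ∑ k ∈ Finset.range N,
      ∑ i ∈ Finset.range (k + 1), ∑ j : Fin n, (w ^ ((i : ℤ) - (j : ℕ)) • (T ^ i) (x j) +
        w ^ (-(i : ℤ) - (j : ℕ)) • (ContinuousLinearMap.adjoint T ^ i) (x j)) := by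
    intro N w hw
    have hw0 : w ≠ 0 := by
      rintro rfl
      simp at hw
    have hconj : (starRingEnd ℂ) w = w⁻¹ := by
      rw [Complex.inv_def, Complex.normSq_eq_norm_sq, hw]
      simp
    have hadj : ContinuousLinearMap.adjoint (geomCesaro (w • T) N) =
        geomCesaro (w⁻¹ • ContinuousLinearMap.adjoint T) N := by
      simp only [geomCesaro, map_sum, adjoint_pow, map_smulₛₗ, hconj]
    rw [hadj, add_apply, geomCesaro_apply, geomCesaro_apply, ← Finset.sum_add_distrib]
    refine Finset.sum_congr rfl fun k _ => ?_
    rw [← Finset.sum_add_distrib]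
    refine Finset.sum_congr rfl fun i _ => ?_
    rw [map_sum, map_sum, ← Finset.sum_add_distrib]
    refine Finset.sum_congr rfl fun j _ => ?_
    rw [smul_pow, smul_pow, smul_apply, smul_apply, map_smul, map_smul, smul_smul, smul_smul]
    congr 2
    · rw [zpow_sub₀ hw0, zpow_natCast, zpow_natCast, inv_pow, div_eq_mul_inv]
    · rw [zpow_sub₀ hw0, zpow_neg, zpow_natCast, zpow_natCast, inv_pow, inv_pow, div_eq_mul_inv]
  have hB0 : 0 ≤ B := by
    have := (sq_nonneg _).trans (hB 1 (by simp) 1)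
    simpa using this
  have hbound : ∀ N : ℕ, ‖∑ k ∈ Finset.range N, c k m‖ ^ 2 ≤ B * N := by
    intro N
    have h1 := (hcoef N).norm_le (B := Real.sqrt (B * N)) (fun z hz => by
      rw [← hval N z hz]
      exact Real.le_sqrt_of_sq_le (hB z hz N)) m
    calc ‖∑ k ∈ Finset.range N, c k m‖ ^ 2 ≤ Real.sqrt (B * N) ^ 2 :=
          pow_le_pow_left₀ (norm_nonneg _) h1 2
      _ = B * N := Real.sq_sqrt (by positivity)
  -- Once k ≥ |m| + n, every index ±(m + j) that can contribute lies in the range, so the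
  -- coefficient no longer depends on k.
  refine eq_zero_of_norm_sum_range_sq_le (u := fun k => c k m) (M := m.natAbs + n) ?_ hbound
  intro k hk
  simp only [c]
  rw [Finset.sum_comm]
  refine Finset.sum_congr rfl fun j _ => ?_
  rw [Finset.sum_add_distrib, toeplitzKernel, add_apply]
  have hj := j.2
  congr 1
  · split_ifs with h0
    · rw [Finset.sum_eq_single (m + (j : ℕ)).toNat]
      · rw [if_pos (by omega)]
      · intro i _ hi
        rw [if_neg (by omega)]
      · intro h
        exact absurd (Finset.mem_range.2 (by omega)) h
    · rw [zero_apply]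
      exact Finset.sum_eq_zero fun i _ => if_neg (by omega)
  · split_ifs with h0
    · rw [Finset.sum_eq_single (-(m + (j : ℕ))).toNat]
      · rw [if_pos (by omega)]
      · intro i _ hi
        rw [if_neg (by omega)]
      · intro h
        exact absurd (Finset.mem_range.2 (by omega)) h
    · rw [zero_apply]
      exact Finset.sum_eq_zero fun i _ => if_neg (by omega)

end Kernel

/-! ### Linear algebra forcing the superdiagonal form -/

section Superdiagonal

variable {T L : EuclideanSpace ℂ (Fin 5) →L[ℂ] EuclideanSpace ℂ (Fin 5)}

/-- The canonical basis of `ℂ⁵`. -/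
noncomputable def stdVec (j : Fin 5) : EuclideanSpace ℂ (Fin 5) := EuclideanSpace.single j 1

local notation "e" => stdVec

theorem inner_stdVec (j : Fin 5) (v : EuclideanSpace ℂ (Fin 5)) : inner ℂ (e j) v = v j := by
  simp [stdVec, EuclideanSpace.inner_single_left]

theorem stdVec_apply (i j : Fin 5) : e j i = if i = j then 1 else 0 := by
  simp [stdVec]

/-- With L = T*, the vectors u, g, v below form a chain: T sends u to g, g to e₁ + v and v to 2s e₀,
while L runs it backwards. Adjointness then places u, g, v on the lines of e₃, e₂, e₁. -/
theorem exists_superdiagonal_of_kernel_eq {s : ℂ} (hs : s ^ 2 = 3) (hsc : (starRingEnd ℂ) s = s)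
    (hL : ∀ u v, inner ℂ (L u) v = inner ℂ u (T v))
    (h1 : -s • T (e 0) - T (T (e 1)) + T (T (T (T (e 3)))) + s • T (T (T (T (T (e 4))))) = 0)
    (h0 : -(2 * s) • e 0 - T (e 1) + T (T (T (e 3))) + s • T (T (T (T (e 4)))) = 0)
    (hm1 : -s • L (e 0) - (2 : ℂ) • e 1 + T (T (e 3)) + s • T (T (T (e 4))) = 0)
    (hm2 : -s • L (L (e 0)) - L (e 1) + T (e 3) + s • T (T (e 4)) = 0)
    (hm3 : -s • L (L (L (e 0))) - L (L (e 1)) + (2 : ℂ) • e 3 + s • T (e 4) = 0)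
    (hm4 : -s • L (L (L (L (e 0)))) - L (L (L (e 1))) + L (e 3) + (2 * s) • e 4 = 0)
    (hm5 : -s • L (L (L (L (L (e 0))))) - L (L (L (L (e 1)))) + L (L (e 3)) + s • L (e 4) = 0) :
    ∃ a b c d : ℂ, T (e 0) = 0 ∧ T (e 1) = a • e 0 ∧ T (e 2) = b • e 1 ∧ T (e 3) = c • e 2 ∧
      T (e 4) = d • e 3 := by
  have hs0 : s ≠ 0 := by
    rintro rfl
    norm_num at hs
  have hL' : ∀ u v, inner ℂ (T u) v = inner ℂ u (L v) := by
    intro u v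
    rw [← inner_conj_symm, ← hL, inner_conj_symm]
  have hT0 : T (e 0) = 0 := by
    -- Applying T to the relation for m = 0 gives that for m = 1, except for the doubled coefficient
    -- of e₀.
    have h2 := congrArg T h0
    simp only [map_add, map_sub, map_smul, map_zero] at h2
    have h3 : s • T (e 0) = 0 := by linear_combination (norm := module) h1 - h2
    exact (smul_eq_zero.1 h3).resolve_left hs0
  have hL4 : L (e 4) = 0 := by
    have h2 := congrArg L hm4
    simp only [map_add, map_sub, map_smul, map_zero] at h2
    have h3 : s • L (e 4) = 0 := by linear_combination (norm := module) h2 - hm5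
    exact (smul_eq_zero.1 h3).resolve_left hs0
  obtain ⟨u, hu⟩ : ∃ u, u = e 3 + s • T (e 4) := ⟨_, rfl⟩
  obtain ⟨v, hv⟩ : ∃ v, v = e 1 + s • L (e 0) := ⟨_, rfl⟩
  obtain ⟨g, hg⟩ : ∃ g, g = T u := ⟨_, rfl⟩
  have hgv : g = L v := by
    rw [hg, hu, hv]
    simp only [map_add, map_smul]
    linear_combination (norm := module) hm2
  have hTg : T g = e 1 + v := by
    rw [hg, hu, hv]
    simp only [map_add, map_smul]
    linear_combination (norm := module) hm1
  have hLg : L g = e 3 + u := by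
    rw [hgv, hu, hv]
    simp only [map_add, map_smul]
    linear_combination (norm := module) -hm3
  have hTv : T v = (2 * s) • e 0 := by
    have h2 : T (T g) = T (e 1) + T v := by rw [hTg, map_add]
    rw [hg, hu] at h2
    simp only [map_add, map_smul] at h2
    linear_combination (norm := module) h0 - h2
  have hLu : L u = (2 * s) • e 4 := by
    have h2 : L (L g) = L (e 3) + L u := by rw [hLg, map_add]
    rw [hgv, hv] at h2
    simp only [map_add, map_smul] at h2
    linear_combination (norm := module) -hm4 - h2
  have hsL : s • L (e 0) = v - e 1 := by rw [hv]; abel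
  have hsT : s • T (e 4) = u - e 3 := by rw [hu]; abel
  have hA : ∀ y, inner ℂ (v - e 1) y = s * (T y) 0 := by
    intro y
    rw [← hsL, inner_smul_left, hsc, hL, inner_stdVec]
  have hB : ∀ y, inner ℂ (u - e 3) y = s * (L y) 4 := by
    intro y
    rw [← hsT, inner_smul_left, hsc, hL', inner_stdVec]
  have hrow4 : ∀ y, (T y) 4 = 0 := by
    intro y
    rw [← inner_stdVec, ← hL, hL4, inner_zero_left]
  have hrow0 : ∀ y, (L y) 0 = 0 := by
    intro y
    rw [← inner_stdVec, ← hL', hT0, inner_zero_left]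
  have hv0 : v 0 = 0 := by
    have := hrow0 (e 0)
    rw [hv]
    simp [stdVec_apply, this]
  have hu4 : u 4 = 0 := by
    have := hrow4 (e 4)
    rw [hu]
    simp [stdVec_apply, this]
  have hg0 : g 0 = 0 := by rw [hgv]; exact hrow0 v
  have hg4 : g 4 = 0 := by rw [hg]; exact hrow4 u
  have hv4 : v 4 = 0 := by
    have := hrow4 g
    rw [hTg] at this
    simpa [stdVec_apply] using this
  have hu0 : u 0 = 0 := by
    have := hrow0 g
    rw [hLg] at this
    simpa [stdVec_apply] using this
  -- Two evaluations, through s L e₀ = v - e₁ and T g = e₁ + v, give ⟨v, u⟩ - u₁ = 0 and ⟨v, u⟩ + u₁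
  -- = 0.
  have hvu : inner ℂ v u = 0 ∧ u 1 = 0 := by
    have h2 := hA u
    rw [← hg, hg0, mul_zero, inner_sub_left, inner_stdVec] at h2
    have h3 : inner ℂ (e 1 + v) u = 0 := by
      rw [← hTg, hL', hLu, inner_smul_right, ← inner_conj_symm, inner_stdVec, hg4]
      simp
    rw [inner_add_left, inner_stdVec] at h3
    constructor
    · linear_combination (h2 + h3) / 2
    · linear_combination (h3 - h2) / 2
  have huv : inner ℂ u v = 0 ∧ v 3 = 0 := by
    have h2 := hB v
    rw [← hgv, hg4, mul_zero, inner_sub_left, inner_stdVec] at h2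
    have h3 : inner ℂ (e 3 + u) v = 0 := by
      rw [← hLg, hL, hTv, inner_smul_right, ← inner_conj_symm, inner_stdVec, hg0]
      simp
    rw [inner_add_left, inner_stdVec] at h3
    constructor
    · linear_combination (h2 + h3) / 2
    · linear_combination (h3 - h2) / 2
  have hvg : inner ℂ v g = 0 := by
    rw [hgv, ← hL', hTv, inner_smul_left, inner_stdVec, hv0, mul_zero]
  have hug : inner ℂ u g = 0 := by
    rw [hg, ← hL, hLu, inner_smul_left, inner_stdVec, hu4, mul_zero]
  have hg1 : g 1 = 0 := by
    have h2 := hA g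
    rw [hTg, inner_sub_left, hvg, inner_stdVec] at h2
    simpa [stdVec_apply, hv0] using h2
  have hg3 : g 3 = 0 := by
    have h2 := hB g
    rw [hLg, inner_sub_left, hug, inner_stdVec] at h2
    simpa [stdVec_apply, hu4] using h2
  have hvv : inner ℂ (v - e 1) v = 6 := by
    rw [hA, hTv]
    simp only [PiLp.smul_apply, stdVec_apply, if_true, smul_eq_mul]
    linear_combination 2 * hs
  have huu : inner ℂ (u - e 3) u = 6 := by
    rw [hB, hLu]
    simp only [PiLp.smul_apply, stdVec_apply, if_true, smul_eq_mul]
    linear_combination 2 * hs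
  -- If g vanished, T g = e₁ + v would give v = -e₁ and ⟨v - e₁, v⟩ = 2 instead of 6.
  have hgne : g 2 ≠ 0 := by
    intro h2
    have hg' : g = 0 := by
      ext i
      fin_cases i <;> simp [hg0, hg1, h2, hg3, hg4]
    have hv' : v = - e 1 := by
      rw [hg', map_zero] at hTg
      linear_combination (norm := module) -hTg
    rw [hv', inner_sub_left, inner_neg_left, inner_neg_right, inner_stdVec] at hvv
    simp [stdVec_apply] at hvv
    norm_num at hvv
  have hgeq : g = g 2 • e 2 := by
    ext i
    fin_cases i <;> simp [hg0, hg1, hg3, hg4, stdVec_apply]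
  have hv2 : v 2 = 0 := by
    have h2 := hvg
    rw [hgeq, inner_smul_right, ← inner_conj_symm, inner_stdVec] at h2
    simpa [hgne] using h2
  have hu2 : u 2 = 0 := by
    have h2 := hug
    rw [hgeq, inner_smul_right, ← inner_conj_symm, inner_stdVec] at h2
    simpa [hgne] using h2
  have hveq : v = v 1 • e 1 := by
    ext i
    fin_cases i <;> simp [hv0, hv2, huv.2, hv4, stdVec_apply]
  have hueq : u = u 3 • e 3 := by
    ext i
    fin_cases i <;> simp [hu0, hvu.2, hu2, hu4, stdVec_apply]
  have hvne : v 1 ≠ 0 := by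
    intro h2
    rw [h2, zero_smul] at hveq
    rw [hveq] at hvv
    simp at hvv
  have hune : u 3 ≠ 0 := by
    intro h2
    rw [h2, zero_smul] at hueq
    rw [hueq] at huu
    simp at huu
  have hinv : ∀ {a : ℂ} {y z : EuclideanSpace ℂ (Fin 5)}, a ≠ 0 → a • y = z → y = a⁻¹ • z := by
    rintro a y z ha rfl
    rw [smul_smul, inv_mul_cancel₀ ha, one_smul]
  refine ⟨(v 1)⁻¹ * (2 * s), (g 2)⁻¹ * (1 + v 1), (u 3)⁻¹ * g 2, s⁻¹ * (u 3 - 1), hT0, ?_, ?_, ?_,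
    ?_⟩
  · rw [mul_smul]
    apply hinv hvne
    rw [← hTv, ← map_smul, ← hveq]
  · rw [mul_smul]
    apply hinv hgne
    rw [← map_smul, ← hgeq, hTg, add_smul, ← hveq, one_smul]
  · rw [mul_smul]
    apply hinv hune
    rw [← map_smul, ← hueq, ← hgeq, hg]
  · rw [mul_smul]
    apply hinv hs0
    rw [hsT, sub_smul, ← hueq, one_smul]

end Superdiagonal

theorem Finset.sum_range_le_sum_range_of_eq_zero {f : ℕ → ℝ} {M : ℕ} (h0 : ∀ i < M, 0 ≤ f i)
    (hf : ∀ i, M ≤ i → f i = 0) (N : ℕ) :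
    ∑ i ∈ Finset.range N, f i ≤ ∑ i ∈ Finset.range M, f i := by
  calc ∑ i ∈ Finset.range N, f i = ∑ i ∈ (Finset.range N).filter (· < M), f i := by
        refine (Finset.sum_subset (Finset.filter_subset _ _) fun i hi hi' => hf i ?_).symm
        by_contra h
        exact hi' (Finset.mem_filter.2 ⟨hi, by omega⟩)
    _ ≤ ∑ i ∈ Finset.range M, f i :=
        Finset.sum_le_sum_of_subset_of_nonneg
          (fun i hi => Finset.mem_range.2 (Finset.mem_filter.1 hi).2)
          fun i hi _ => h0 i (Finset.mem_range.1 hi)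

/-! ### Explicit computations for the truncated shift -/

section Shift

local notation "e" => stdVec

local notation "S" => matOp truncShift

theorem ofReal_sqrt_three_sq : ((Real.sqrt 3 : ℝ) : ℂ) ^ 2 = 3 := by
  rw [← Complex.ofReal_pow, Real.sq_sqrt (by norm_num)]
  norm_num

theorem truncShift_pow_five : truncShift ^ 5 = 0 := by
  have h : (!![0, 1, 0, 0, 0; 0, 0, 1, 0, 0; 0, 0, 0, 1, 0; 0, 0, 0, 0, 1; 0, 0, 0, 0, 0] :
      Matrix (Fin 5) (Fin 5) ℂ) ^ 5 = 0 := by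
    ext i j
    fin_cases i <;> fin_cases j <;> simp [pow_succ, Matrix.mul_apply, Fin.sum_univ_five]
  rw [truncShift, smul_pow, h, smul_zero]

theorem matOp_stdVec_apply (M : Matrix (Fin 5) (Fin 5) ℂ) (i j : Fin 5) :
    matOp M (e j) i = M i j := by
  simp [matOp, stdVec]

theorem matOp_truncShift_stdVec :
    ∃ a : ℂ, ((Real.sqrt 3 : ℝ) : ℂ) * a = 2 ∧ S (e 0) = 0 ∧ S (e 1) = a • e 0 ∧
      S (e 2) = a • e 1 ∧ S (e 3) = a • e 2 ∧ S (e 4) = a • e 3 := by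
  refine ⟨((1 / Real.cos (Real.pi / 6) : ℝ) : ℂ), ?_, ?_, ?_, ?_, ?_, ?_⟩
  · rw [Real.cos_pi_div_six, ← Complex.ofReal_mul]
    have : Real.sqrt 3 ≠ 0 := by positivity
    rw [show √3 * (1 / (√3 / 2)) = 2 by field_simp]
    norm_num
  all_goals
    ext i
    rw [matOp_stdVec_apply]
    fin_cases i <;> simp [truncShift, stdVec_apply]

theorem matOp_truncShift_pow (i : ℕ) (hi : 5 ≤ i) : S ^ i = 0 := by
  obtain ⟨k, rfl⟩ := Nat.exists_eq_add_of_le hi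
  have h : S ^ 5 = 0 := by
    rw [matOp, ← map_pow, truncShift_pow_five, map_zero]
  rw [pow_add, h, zero_mul]

theorem exists_norm_geomCesaro_truncShift_le :
    ∃ D : ℝ, 0 ≤ D ∧ ∀ w : ℂ, ‖w‖ = 1 → ∀ N : ℕ, ‖geomCesaro (w • S) N‖ ≤ D * N := by
  refine ⟨∑ i ∈ Finset.range 5, ‖S ^ i‖, Finset.sum_nonneg fun _ _ => norm_nonneg _,
    fun w hw N => ?_⟩
  have h1 : ∀ k, ‖∑ i ∈ Finset.range (k + 1), (w • S) ^ i‖ ≤ ∑ i ∈ Finset.range 5, ‖S ^ i‖ := by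
    intro k
    refine (norm_sum_le _ _).trans ?_
    have h2 : ∀ i, ‖(w • S) ^ i‖ = ‖S ^ i‖ := by
      intro i
      rw [smul_pow, norm_smul, norm_pow, hw, one_pow, one_mul]
    simp only [h2]
    exact Finset.sum_range_le_sum_range_of_eq_zero (fun _ _ => norm_nonneg _)
      (fun i hi => by rw [matOp_truncShift_pow i hi, norm_zero]) _
  calc ‖geomCesaro (w • S) N‖ ≤ ∑ k ∈ Finset.range N, ‖∑ i ∈ Finset.range (k + 1), (w • S) ^ i‖ :=
        norm_sum_le _ _
    _ ≤ ∑ k ∈ Finset.range N, ∑ i ∈ Finset.range 5, ‖S ^ i‖ := Finset.sum_le_sum fun k _ => h1 k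
    _ = _ := by rw [Finset.sum_const, Finset.card_range, nsmul_eq_mul, mul_comm]

/-- The coefficients, in the canonical basis, of the kernel vectors of the shift. -/
noncomputable def kernelCoeff : Fin 5 → ℂ :=
  ![-((Real.sqrt 3 : ℝ) : ℂ), -1, 0, 1, ((Real.sqrt 3 : ℝ) : ℂ)]

/-- The vector spanning the kernel of the real part of `(1 - w S)⁻¹`, for `w` on the circle. -/
noncomputable def kernelVec (w : ℂ) : EuclideanSpace ℂ (Fin 5) :=
  ∑ j : Fin 5, (w⁻¹ ^ (j : ℕ)) • kernelCoeff j • e j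

theorem re_inner_geomCesaro_truncShift_le {w : ℂ} (hw : ‖w‖ = 1) (N : ℕ) :
    (inner ℂ (kernelVec w) (geomCesaro (w • S) N (kernelVec w))).re ≤ 36 := by
  obtain ⟨a, ha, hS0, hS1, hS2, hS3, hS4⟩ := matOp_truncShift_stdVec
  obtain ⟨s, hs⟩ : ∃ s : ℂ, s = ((Real.sqrt 3 : ℝ) : ℂ) := ⟨_, rfl⟩
  have hs2 : s ^ 2 = 3 := by rw [hs, ofReal_sqrt_three_sq]
  have hsc : (starRingEnd ℂ) s = s := by rw [hs, Complex.conj_ofReal]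
  rw [← hs] at ha
  have hw0 : w ≠ 0 := by
    rintro rfl
    simp at hw
  have hconj : (starRingEnd ℂ) w = w⁻¹ := by
    rw [Complex.inv_def, Complex.normSq_eq_norm_sq, hw]
    simp
  -- In this rotated orthonormal basis wS acts as S does in the canonical one, so w disappears from
  -- the computation.
  let d : Fin 5 → EuclideanSpace ℂ (Fin 5) := fun j => (w⁻¹ ^ (j : ℕ)) • e j
  obtain ⟨x, hx⟩ : ∃ x, x = kernelVec w := ⟨_, rfl⟩
  have hxd : x = -s • d 0 - d 1 + d 3 + s • d 4 := by
    rw [hx]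
    simp only [kernelVec, kernelCoeff, ← hs, Fin.sum_univ_five, d]
    simp [smul_smul, mul_comm s]
    module
  have hd : ∀ i j, inner ℂ (d i) (d j) = if i = j then 1 else 0 := by
    intro i j
    simp only [d, inner_smul_left, inner_smul_right, inner_stdVec, stdVec_apply, map_pow, map_inv₀,
      hconj, inv_inv]
    split_ifs with h
    · subst h
      rw [mul_one, ← mul_pow, inv_mul_cancel₀ hw0, one_pow]
    · simp
  have hd0 : (w • S) (d 0) = 0 := by simp [d, hS0]
  have hd1 : (w • S) (d 1) = a • d 0 := by simp [d, hS1, smul_smul, hw0]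
  have hd2 : (w • S) (d 2) = a • d 1 := by
    simp only [d, smul_apply, map_smul, hS2, smul_smul]
    congr 1
    simp
    field_simp
  have hd3 : (w • S) (d 3) = a • d 2 := by
    simp only [d, smul_apply, map_smul, hS3, smul_smul]
    congr 1
    simp
    field_simp
  have hd4 : (w • S) (d 4) = a • d 3 := by
    simp only [d, smul_apply, map_smul, hS4, smul_smul]
    congr 1
    simp
    field_simp
  have hp1 : ((w • S) ^ 1) x = -a • d 0 + a • d 2 + (s * a) • d 3 := by
    rw [pow_one, hxd]
    simp only [map_add, map_sub, map_smul, hd0, hd1, hd3, hd4]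
    module
  have hp2 : ((w • S) ^ 2) x = a ^ 2 • d 1 + (s * a ^ 2) • d 2 := by
    rw [pow_succ', mul_apply_eq_comp, hp1]
    simp only [map_add, map_smul, hd0, hd2, hd3]
    module
  have hp3 : ((w • S) ^ 3) x = a ^ 3 • d 0 + (s * a ^ 3) • d 1 := by
    rw [pow_succ', mul_apply_eq_comp, hp2]
    simp only [map_add, map_smul, hd1, hd2]
    module
  have hp4 : ((w • S) ^ 4) x = (s * a ^ 4) • d 0 := by
    rw [pow_succ', mul_apply_eq_comp, hp3]
    simp only [map_add, map_smul, hd0, hd1]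
    module
  have hxi : inner ℂ x (d 0) = -s ∧ inner ℂ x (d 1) = -1 ∧ inner ℂ x (d 2) = 0 ∧
      inner ℂ x (d 3) = 1 ∧ inner ℂ x (d 4) = s := by
    rw [hxd]
    simp only [inner_add_left, inner_sub_left, inner_smul_left, hd, hsc, map_neg]
    simp
  obtain ⟨hx0, hx1, hx2, hx3, hx4⟩ := hxi
  have ha2 : a ^ 2 = 4 / 3 := by
    have : s ^ 2 * a ^ 2 = 4 := by rw [← mul_pow, ha]; norm_num
    rw [hs2] at this
    linear_combination this / 3
  -- These moments 8, 4, -4/3, -16/3, -16/3 sum to zero, so their partial sums 8, 12, 32/3, 16/3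
  -- vanish afterwards and total 36.
  let r : ℕ → ℂ := fun i => inner ℂ x (((w • S) ^ i) x)
  have hr0 : r 0 = 8 := by
    have : r 0 = inner ℂ x x := by simp [r]
    rw [this]
    nth_rw 2 [hxd]
    simp only [inner_add_right, inner_sub_right, inner_smul_right, hx0, hx1, hx3, hx4]
    linear_combination 2 * hs2
  have hr1 : r 1 = 4 := by
    simp only [r, hp1, inner_add_right, inner_smul_right, hx0, hx2, hx3]
    linear_combination 2 * ha
  have hr2 : r 2 = -(4 / 3) := by
    simp only [r, hp2, inner_add_right, inner_smul_right, hx1, hx2]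
    linear_combination -ha2
  have hr3 : r 3 = -(16 / 3) := by
    simp only [r, hp3, inner_add_right, inner_smul_right, hx0, hx1]
    linear_combination -2 * a ^ 2 * ha - 4 * ha2
  have hr4 : r 4 = -(16 / 3) := by
    simp only [r, hp4, inner_smul_right, hx0]
    linear_combination -a ^ 4 * hs2 - 3 * (a ^ 2 + 4 / 3) * ha2
  have hr5 : ∀ i, 5 ≤ i → r i = 0 := by
    intro i hi
    simp only [r, smul_pow, matOp_truncShift_pow i hi]
    simp
  let t : ℕ → ℝ := fun k => (∑ i ∈ Finset.range (k + 1), r i).re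
  have ht : (inner ℂ x (geomCesaro (w • S) N x)).re = ∑ k ∈ Finset.range N, t k := by
    simp only [geomCesaro_apply, inner_sum, Complex.re_sum, t, r]
  have ht4 : ∀ k, 4 ≤ k → t k = 0 := by
    intro k hk
    have : ∑ i ∈ Finset.range (k + 1), r i = ∑ i ∈ Finset.range 5, r i := by
      refine (Finset.sum_subset (fun i hi => ?_) fun i _ hi => ?_).symm
      · rw [Finset.mem_range] at hi ⊢
        omega
      · rw [Finset.mem_range] at hi
        exact hr5 i (by omega)
    simp only [t]
    rw [this]
    simp only [Finset.sum_range_succ, Finset.sum_range_zero, hr0, hr1, hr2, hr3, hr4]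
    norm_num
  have ht0 : t 0 = 8 := by simp [t, Finset.sum_range_succ, hr0]
  have ht1 : t 1 = 12 := by
    simp only [t, Finset.sum_range_succ, Finset.sum_range_zero, hr0, hr1]
    norm_num
  have ht2 : t 2 = 32 / 3 := by
    simp only [t, Finset.sum_range_succ, Finset.sum_range_zero, hr0, hr1, hr2]
    norm_num
  have ht3 : t 3 = 16 / 3 := by
    simp only [t, Finset.sum_range_succ, Finset.sum_range_zero, hr0, hr1, hr2, hr3]
    norm_num
  have htn : ∀ k < 4, 0 ≤ t k := by
    intro k hk
    interval_cases k <;> simp only [ht0, ht1, ht2, ht3] <;> norm_num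
  rw [← hx, ht]
  calc ∑ k ∈ Finset.range N, t k ≤ ∑ k ∈ Finset.range 4, t k :=
        Finset.sum_range_le_sum_range_of_eq_zero htn ht4 N
    _ = 36 := by
        simp only [Finset.sum_range_succ, Finset.sum_range_zero, ht0, ht1, ht2, ht3]
        norm_num

end Shift

/-! ### Elements of the Harnack part -/

section Main

local notation "e" => stdVec

local notation "S" => matOp truncShift

theorem sum_toeplitzKernel_kernelCoeff_eq_zero
    {T : EuclideanSpace ℂ (Fin 5) →L[ℂ] EuclideanSpace ℂ (Fin 5)}
    (hT : T ∈ harnackPart 2 S) (m : ℤ) :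
    ∑ j : Fin 5, toeplitzKernel T (m + (j : ℕ)) (kernelCoeff j • e j) = 0 := by
  obtain ⟨hT, hTS, -⟩ := hT
  obtain ⟨c, hc0, hc⟩ := hTS.exists_re_inner_geomCesaro_le
  obtain ⟨D, hD0, hD⟩ := exists_norm_geomCesaro_truncShift_le
  refine sum_toeplitzKernel_eq_zero T (fun j => kernelCoeff j • e j)
    -- The first factor, times N, bounds the form of X + X*, its + 1 keeping the bound positive; the
    -- second bounds that form at `kernelVec w`.
    (B := (2 * (c * D) + 1) * (2 * (c * 36))) (fun w hw N => ?_) m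
  rw [← kernelVec]
  rcases Nat.eq_zero_or_pos N with rfl | hN
  · simp [geomCesaro]
  have hN' : (0 : ℝ) < N := by exact_mod_cast hN
  obtain ⟨X, hX⟩ : ∃ X, X = geomCesaro (w • T) N := ⟨_, rfl⟩
  have hin : ∀ h, (inner ℂ h ((X + ContinuousLinearMap.adjoint X) h)).re =
      2 * (inner ℂ h (X h)).re := by
    intro h
    have := re_inner_opRe X h
    simp only [opRe, smul_apply, inner_smul_right] at this
    rw [show (2⁻¹ : ℂ) = ((2⁻¹ : ℝ) : ℂ) by push_cast; rfl, Complex.re_ofReal_mul] at this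
    linarith
  have hcD : 0 ≤ c * D := mul_nonneg hc0 hD0
  have key := norm_sq_apply_le_of_re_inner_le (F := X + ContinuousLinearMap.adjoint X)
    (D := (2 * (c * D) + 1) * N) (by rw [map_add, ContinuousLinearMap.adjoint_adjoint, add_comm])
    (by positivity)
    (fun h => by
      rw [hin, hX]
      have := hT.re_inner_geomCesaro_nonneg hw.le N h
      linarith)
    (fun h => by
      rw [hin, hX]
      have h1 := hc w hw.le N h
      have h2 : (inner ℂ h (geomCesaro (w • S) N h)).re ≤ D * N * ‖h‖ ^ 2 :=
        calc (inner ℂ h (geomCesaro (w • S) N h)).re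
            ≤ ‖inner ℂ h (geomCesaro (w • S) N h)‖ := Complex.re_le_norm _
          _ ≤ ‖h‖ * ‖geomCesaro (w • S) N h‖ := norm_inner_le_norm _ _
          _ ≤ ‖h‖ * (D * N * ‖h‖) := by
              refine mul_le_mul_of_nonneg_left ?_ (norm_nonneg _)
              exact ((geomCesaro (w • S) N).le_opNorm h).trans
                (mul_le_mul_of_nonneg_right (hD w hw N) (norm_nonneg _))
          _ = D * N * ‖h‖ ^ 2 := by ring
      have h3 := mul_le_mul_of_nonneg_left h2 hc0
      have h4 : 0 ≤ N * ‖h‖ ^ 2 := by positivity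
      linarith)
    (kernelVec w)
  rw [hin, hX] at key
  have h1 := hc w hw.le N (kernelVec w)
  have h2 := mul_le_mul_of_nonneg_left (re_inner_geomCesaro_truncShift_le hw N) hc0
  refine key.trans ?_
  rw [mul_right_comm]
  refine mul_le_mul_of_nonneg_right ?_ hN'.le
  refine mul_le_mul_of_nonneg_left ?_ (by positivity)
  linarith

theorem exists_superdiagonal_of_mem_harnackPart
    {T : EuclideanSpace ℂ (Fin 5) →L[ℂ] EuclideanSpace ℂ (Fin 5)} (hT : T ∈ harnackPart 2 S) :
    ∃ a b c d : ℂ, T (e 0) = 0 ∧ T (e 1) = a • e 0 ∧ T (e 2) = b • e 1 ∧ T (e 3) = c • e 2 ∧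
      T (e 4) = d • e 3 := by
  have h := sum_toeplitzKernel_kernelCoeff_eq_zero hT
  obtain ⟨s, hs⟩ : ∃ s : ℂ, s = ((Real.sqrt 3 : ℝ) : ℂ) := ⟨_, rfl⟩
  simp only [Fin.sum_univ_five, kernelCoeff, ← hs] at h
  refine exists_superdiagonal_of_kernel_eq (L := ContinuousLinearMap.adjoint T) (s := s)
    (by rw [hs, ofReal_sqrt_three_sq]) (by rw [hs, Complex.conj_ofReal])
    (fun u v => ContinuousLinearMap.adjoint_inner_left _ _ _) ?_ ?_ ?_ ?_ ?_ ?_ ?_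
  · have h' := h 1
    simp [toeplitzKernel, pow_succ] at h'
    linear_combination (norm := module) h'
  · have h' := h 0
    simp [toeplitzKernel, pow_succ] at h'
    linear_combination (norm := module) h'
  · have h' := h (-1)
    simp [toeplitzKernel, pow_succ] at h'
    linear_combination (norm := module) h'
  · have h' := h (-2)
    simp [toeplitzKernel, pow_succ] at h'
    linear_combination (norm := module) h'
  · have h' := h (-3)
    simp [toeplitzKernel, pow_succ] at h'
    linear_combination (norm := module) h'
  · have h' := h (-4)
    simp [toeplitzKernel, pow_succ] at h'
    linear_combination (norm := module) h'
  · have h' := h (-5)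
    simp [toeplitzKernel, pow_succ] at h'
    linear_combination (norm := module) h'

theorem exists_eq_superdiagonal_of_mem_harnackPart {T : Matrix (Fin 5) (Fin 5) ℂ}
    (hT : matOp T ∈ harnackPart 2 S) :
    ∃ a b c d : ℂ, T = !![0, a, 0, 0, 0; 0, 0, b, 0, 0; 0, 0, 0, c, 0; 0, 0, 0, 0, d;
      0, 0, 0, 0, 0] := by
  obtain ⟨a, b, c, d, h0, h1, h2, h3, h4⟩ := exists_superdiagonal_of_mem_harnackPart hT
  refine ⟨a, b, c, d, ?_⟩
  ext i j
  rw [← matOp_stdVec_apply T i j]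
  fin_cases j <;> simp only [Fin.zero_eta, Fin.mk_one, Fin.reduceFinMk, h0, h1, h2, h3, h4] <;>
    fin_cases i <;> simp [stdVec_apply]

theorem isNilpotent_of_blockForm_mem_harnackPart {A : Fin 3 → ℂ} {R : Matrix (Fin 3) (Fin 3) ℂ}
    {B : Fin 3 → ℂ} (hT : matOp (blockForm A R B) ∈ harnackPart 2 S) : IsNilpotent R := by
  obtain ⟨a, b, c, d, h⟩ := exists_eq_superdiagonal_of_mem_harnackPart hT
  have hR : R = !![0, b, 0; 0, 0, c; 0, 0, 0] := by
    ext i j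
    have hij := congrFun (congrFun h i.succ.castSucc) j.succ.castSucc
    fin_cases i <;> fin_cases j <;> simpa [blockForm] using hij
  refine ⟨3, ?_⟩
  rw [hR]
  ext i j
  fin_cases i <;> fin_cases j <;> simp [pow_succ, Matrix.mul_apply, Fin.sum_univ_three]

theorem eq_zero_of_mem_spectrum_of_isNilpotent {n : Type*} [Fintype n] [DecidableEq n] [Nonempty n]
    {R : Matrix n n ℂ} (hR : IsNilpotent R) {l : ℂ} (hl : l ∈ spectrum ℂ R) : l = 0 := by
  obtain ⟨k, hk⟩ := hR
  have h := spectrum.pow_mem_pow R k hl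
  rw [hk, spectrum.zero_eq] at h
  exact eq_zero_of_pow_eq_zero h

end Main

theorem mainTheorem3 :
    -- every element of the Harnack part of the shift has the block form
    (∀ T : Matrix (Fin 5) (Fin 5) ℂ, matOp T ∈ harnackPart 2 (matOp truncShift) →
      ∃ (A : Fin 3 → ℂ) (R : Matrix (Fin 3) (Fin 3) ℂ) (B : Fin 3 → ℂ), T = blockForm A R B) ∧
    -- its middle block never has two distinct nonzero eigenvalues in the open disk, besides `0`
    (¬ ∃ (T : Matrix (Fin 5) (Fin 5) ℂ) (A : Fin 3 → ℂ) (R : Matrix (Fin 3) (Fin 3) ℂ)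
        (B : Fin 3 → ℂ) (l₁ l₂ : ℂ),
      matOp T ∈ harnackPart 2 (matOp truncShift) ∧ T = blockForm A R B ∧
      ‖l₁‖ < 1 ∧ ‖l₂‖ < 1 ∧ l₁ ≠ 0 ∧ l₂ ≠ 0 ∧ l₁ ≠ l₂ ∧
      spectrum ℂ R = {0, l₁, l₂}) ∧
    -- its middle block is nilpotent
    (∀ (T : Matrix (Fin 5) (Fin 5) ℂ) (A : Fin 3 → ℂ) (R : Matrix (Fin 3) (Fin 3) ℂ)
        (B : Fin 3 → ℂ),
      matOp T ∈ harnackPart 2 (matOp truncShift) → T = blockForm A R B → IsNilpotent R) := by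
  refine ⟨fun T hT => ?_, ?_, ?_⟩
  · obtain ⟨a, b, c, d, h⟩ := exists_eq_superdiagonal_of_mem_harnackPart hT
    refine ⟨![a, 0, 0], !![0, b, 0; 0, 0, c; 0, 0, 0], ![0, 0, d], ?_⟩
    rw [h]
    ext i j
    fin_cases i <;> fin_cases j <;> simp [blockForm]
  · rintro ⟨T, A, R, B, l₁, l₂, hT, rfl, -, -, h₁, -, -, hR⟩
    exact h₁ (eq_zero_of_mem_spectrum_of_isNilpotent
      (isNilpotent_of_blockForm_mem_harnackPart hT) (by simp [hR]))
  · rintro T A R B hT rfl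
    exact isNilpotent_of_blockForm_mem_harnackPart hT
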